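/- **Setting.** Permutations act on $\mathbb R^n$ by $(\sigma x)_i=x_{\sigma^{-1}(i)}$. Let $P(\sigma)$ be the partition of $\{1,\dots,n\}$ into the cycles of $\sigma$ (fixed points are singletons), and let $P(x)$ be the partition in which $i,j$ share a block iff $x_i=x_j$. Write $\sigma'\succsim\sigma$ if $P(\sigma')$ refines $P(\sigma)$, and put $\Delta(\sigma)=\{x: P(x)=P(\sigma)\}$. A set $S$ is strongly symmetric if $\sigma S=S$ for every permutation $\sigma$ that fixes some point of $S$. Let $\mathcal M\subset\mathbb R^n$ be a locally symmetric $C^2$ manifold of dimension $d$. That is, $\mathcal M$ is a connected $C^2$ submanifold of dimension $d$, it contains a vector with nonincreasing coordinates, and every $x\in\mathcal M$ has a ball $B(x,\delta)$ with $\mathcal M\cap B(x,\delta)$ strongly symmetric. Let $\sigma_*$ be a characteristic permutation of $\mathcal M$, i.e. $\mathcal M\cap B(y,\rho)\subset\Delta(\sigma_*)$ for some $y\in\mathcal M$, $\rho>0$. Let $\bar x\in\mathcal M\cap\Delta(\sigma)$, let $T$ and $N=T^\perp$ be the tangent and normal spaces of $\mathcal M$ at $\bar x$, and let $N^{\rm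 red}=N\cap\Delta(\sigma)^{\perp\perp}$. Let $\bar\pi_T$ and $\bar\pi_N^{\rm red}$ be the orthogonal projections onto $\bar x+T$ and $\bar x+N^{\rm red}$. Call $\delta>0$ *admissible* if $B(\bar x,\delta)$ meets only strata $\Delta(\sigma')$ with $\sigma'\succsim\sigma$, $\mathcal M\cap B(\bar x,\delta)$ is strongly symmetric, and $\bar\pi_T$ maps $\mathcal M\cap B(\bar x,\delta)$ $C^2$-diffeomorphically onto a relatively open subset $U_\delta$ of $\bar x+T$. For such $\delta$ define $\phi:U_\delta\to N$ by letting $p+\phi(p)$ be the unique point of $\mathcal M\cap B(\bar x,\delta)$ that $\bar\pi_T$ maps to $p$. For $x\in\mathbb R^n$ let $x^F$ and $x^M$ be the subvectors of the coordinates of $x$ with indices fixed, respectively moved, by $\sigma_*$. For $\delta_1,\delta_2>0$ let $$\mathcal B=\{x: \|x^F-\bar x^F\|<\delta_1,\ \|x^M-\bar x^M\|<\delta_2\},\qquad \mathcal D=(\bar x+T\oplus N^{\rm red})\cap\mathcal B .$$ Call $(\delta_1,\delta_2)$ *admissible for $\delta$* if $\mathcal B\subset B(\bar x,\delta)$ and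 $\bar\pi_T(\mathcal D)\subset U_\delta$. **Theorem.** All sufficiently small $\delta>0$ are admissible. For every admissible $\delta$, all pairs of sufficiently small $\delta_1,\delta_2>0$ are admissible for $\delta$. For every admissible $\delta$ and every pair $(\delta_1,\delta_2)$ admissible for $\delta$, the map $$\bar\phi(x)=\bar x+\phi(\bar\pi_T(x))-\bar\pi_N^{\rm red}(x)$$ has the following properties. 1. It is well defined from $\mathcal D$ to $N^{\rm red}$. 2. It is a local equation of $\mathcal M$ around $\bar x$ on $\mathcal D$: the set $\mathcal D$ is relatively open in $\bar x+T\oplus N^{\rm red}$; $\bar\phi$ is of class $C^2$ on $\mathcal D$; its Jacobian at $\bar x$, a linear map $T\oplus N^{\rm red}\to N^{\rm red}$, has full rank (is onto); and for $x\in\mathcal B$ one has $x\in\mathcal M$ if and only if $x\in\mathcal D$ and $\bar\phi(x)=0$. 3. It is locally symmetric: for every $\sigma'\succsim\sigma$ and $x\in\mathcal D$ one has $\sigma'x\in\mathcal D$ and $\bar\phi(\sigma'x)=\bar\phi(x)$. -/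

import Mathlib

open Set Filter Topology Metric

noncomputable section

/-- `ℝⁿ` with its Euclidean norm. -/
abbrev RSpace (n : ℕ) : Type := EuclideanSpace ℝ (Fin n)

/-! ### Permutations, partitions and strata -/

/-- The action of permutations on `ℝⁿ`: `(σ x)_i = x_{σ⁻¹ i}`. -/
def permAct {n : ℕ} (σ : Equiv.Perm (Fin n)) (x : RSpace n) : RSpace n :=
  WithLp.toLp 2 (fun i => x (σ⁻¹ i))

/-- The partition `P(σ)` of the index set into the cycles of `σ` (fixed points give singletons),
recorded as an equivalence relation. -/
def permPartition {n : ℕ} (σ : Equiv.Perm (Fin n)) : Setoid (Fin n) :=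
  Equiv.Perm.SameCycle.setoid σ

/-- The partition `P(x)` of the index set: `i`, `j` are in the same block iff `x_i = x_j`. -/
def pointPartition {n : ℕ} (x : RSpace n) : Setoid (Fin n) :=
  Setoid.ker (fun i => x i)

/-- `σ ≾ σ'`: the partition `P(σ')` is a refinement of `P(σ)`. -/
def PermLE {n : ℕ} (σ σ' : Equiv.Perm (Fin n)) : Prop :=
  permPartition σ' ≤ permPartition σ

/-- The stratum `Δ(σ) = {x : P(x) = P(σ)}`. -/
def stratum {n : ℕ} (σ : Equiv.Perm (Fin n)) : Set (RSpace n) :=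
  {x | pointPartition x = permPartition σ}

/-- `Δ(σ)^⊥`. -/
def stratumPerp {n : ℕ} (σ : Equiv.Perm (Fin n)) : Submodule ℝ (RSpace n) :=
  (Submodule.span ℝ (stratum σ))ᗮ

/-- `Δ(σ)^⊥⊥`. -/
def stratumBiperp {n : ℕ} (σ : Equiv.Perm (Fin n)) : Submodule ℝ (RSpace n) :=
  (stratumPerp σ)ᗮ

/-- The permutations `σ` with `P(σ)` finer than `P(x)`; these are exactly the permutations
that fix `x`. -/
def fixPerms {n : ℕ} (x : RSpace n) : Set (Equiv.Perm (Fin n)) :=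
  {σ | permAct σ x = x}

/-! ### Locally symmetric manifolds -/

/-- `M` is a `C^k` submanifold of `ℝⁿ` of dimension `d` (without boundary): around each of its
points it is the zero set of a `C^k` map into `ℝ^{n-d}` whose Jacobian at the point has full
rank. -/
def IsSubmanifold {n : ℕ} (k : WithTop ℕ∞) (d : ℕ) (M : Set (RSpace n)) : Prop :=
  d ≤ n ∧ M.Nonempty ∧
    ∀ x ∈ M, ∃ U : Set (RSpace n), IsOpen U ∧ x ∈ U ∧
      ∃ f : RSpace n → EuclideanSpace ℝ (Fin (n - d)),
        ContDiffOn ℝ k f U ∧ Function.Surjective (fderiv ℝ f x) ∧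
          ∀ y ∈ U, (y ∈ M ↔ f y = 0)

/-- Invariance of `S` under all permutations that fix at least one point of `S`. -/
def IsStronglySymmetric {n : ℕ} (S : Set (RSpace n)) : Prop :=
  ∀ x ∈ S, ∀ σ ∈ fixPerms x, permAct σ '' S = S

/-- Locally symmetric sets. As part of the notion, the set has to contain a vector with
nonincreasing coordinates. -/
def IsLocallySymmetric {n : ℕ} (S : Set (RSpace n)) : Prop :=
  (∃ x ∈ S, Antitone (fun i => x i)) ∧
    ∀ x ∈ S, ∃ δ : ℝ, 0 < δ ∧ IsStronglySymmetric (S ∩ ball x δ)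

/-- A `C^k` locally symmetric manifold of dimension `d`: a connected `C^k` submanifold that is
a locally symmetric set. -/
structure IsLocallySymmetricManifold {n : ℕ} (k : WithTop ℕ∞) (d : ℕ)
    (M : Set (RSpace n)) : Prop where
  submanifold : IsSubmanifold k d M
  connected : IsConnected M
  symmetric : IsLocallySymmetric M

/-- `σs` is a characteristic permutation of `M`: some nonempty relatively open piece of `M` lies
in the stratum `Δ(σs)`. -/
def IsCharacteristic {n : ℕ} (M : Set (RSpace n)) (σs : Equiv.Perm (Fin n)) : Prop :=
  ∃ x ∈ M, ∃ δ : ℝ, 0 < δ ∧ M ∩ ball x δ ⊆ stratum σs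

/-! ### Tangent and normal spaces, projections -/

/-- The tangent space `T_M(x)`: the velocities at `x` of `C¹` curves in `M` through `x`. (For a
submanifold these velocities already form a linear subspace; the span only serves to have a
subspace for every set `M`.) -/
def tangentSpaceAt {n : ℕ} (M : Set (RSpace n)) (x : RSpace n) : Submodule ℝ (RSpace n) :=
  Submodule.span ℝ
    {v | ∃ γ : ℝ → RSpace n, ContDiffAt ℝ 1 γ 0 ∧ γ 0 = x ∧ (∀ᶠ t in 𝓝 (0 : ℝ), γ t ∈ M) ∧
      deriv γ 0 = v}

/-- The normal space `N_M(x)`. -/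
def normalSpaceAt {n : ℕ} (M : Set (RSpace n)) (x : RSpace n) : Submodule ℝ (RSpace n) :=
  (tangentSpaceAt M x)ᗮ

/-- The reduced normal space `N_M(x) ∩ Δ(σ)^⊥⊥`. -/
def reducedNormal {n : ℕ} (M : Set (RSpace n)) (σ : Equiv.Perm (Fin n)) (x : RSpace n) :
    Submodule ℝ (RSpace n) :=
  normalSpaceAt M x ⊓ stratumBiperp σ

/-- The direction `T_M(x) ⊕ (N_M(x) ∩ Δ(σ)^⊥⊥)` of the reduced affine space through `x`. -/
def reducedDirection {n : ℕ} (M : Set (RSpace n)) (σ : Equiv.Perm (Fin n)) (x : RSpace n) :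
    Submodule ℝ (RSpace n) :=
  tangentSpaceAt M x ⊔ reducedNormal M σ x

/-- The orthogonal projection of `x` onto the affine space `a + V`. -/
def affProj {n : ℕ} (V : Submodule ℝ (RSpace n)) (a x : RSpace n) : RSpace n :=
  a + V.starProjection (x - a)

/-- The projection onto the affine tangent space `a + T_M(a)`. -/
def projT {n : ℕ} (M : Set (RSpace n)) (a x : RSpace n) : RSpace n :=
  affProj (tangentSpaceAt M a) a x

/-- The projection onto the affine reduced normal space `a + (N_M(a) ∩ Δ(σ)^⊥⊥)`. -/
def projNRed {n : ℕ} (M : Set (RSpace n)) (σ : Equiv.Perm (Fin n)) (a x : RSpace n) :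
    RSpace n :=
  affProj (reducedNormal M σ a) a x

/-! ### Tangential parametrization -/

/-- The projection of `M ∩ B(a, δ)` to the affine tangent space: the domain on which the
tangential parametrization lives. -/
def paramDomain {n : ℕ} (M : Set (RSpace n)) (a : RSpace n) (δ : ℝ) : Set (RSpace n) :=
  projT M a '' (M ∩ ball a δ)

/-- The tangential parametrization `ψ`: the inverse of the projection
`M ∩ B(a, δ) → a + T_M(a)`. It is meaningful on `paramDomain M a δ` when that projection is
injective on `M ∩ B(a, δ)`. -/
def tangParam {n : ℕ} (M : Set (RSpace n)) (a : RSpace n) (δ : ℝ) (p : RSpace n) : RSpace n :=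
  Function.invFunOn (projT M a) (M ∩ ball a δ) p

/-- The normal displacement `φ(p) = ψ(p) - p`. -/
def tangDisp {n : ℕ} (M : Set (RSpace n)) (a : RSpace n) (δ : ℝ) (p : RSpace n) : RSpace n :=
  tangParam M a δ p - p

/-- The conditions on the radius `δ` of the ball around `a ∈ M ∩ Δ(σ)`: the ball meets only
strata `Δ(σ')` with `σ' ≿ σ`, the piece `M ∩ B(a, δ)` is strongly symmetric, and the projection
to the affine tangent space maps this piece `C²`-diffeomorphically onto a relatively open subset
of the affine tangent space. -/
structure IsAdmissibleRadius {n : ℕ} (M : Set (RSpace n)) (σ : Equiv.Perm (Fin n))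
    (a : RSpace n) (δ : ℝ) : Prop where
  pos : 0 < δ
  strata : ∀ σ' : Equiv.Perm (Fin n), (stratum σ' ∩ ball a δ).Nonempty → PermLE σ σ'
  symmetric : IsStronglySymmetric (M ∩ ball a δ)
  injOn : InjOn (projT M a) (M ∩ ball a δ)
  isOpen : IsOpen {u : tangentSpaceAt M a | a + (u : RSpace n) ∈ paramDomain M a δ}
  contDiffOn : ContDiffOn ℝ 2 (fun u : tangentSpaceAt M a => tangParam M a δ (a + (u : RSpace n)))
    {u : tangentSpaceAt M a | a + (u : RSpace n) ∈ paramDomain M a δ}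

/-! ### Canonical split and the reduced domain -/

/-- `x^F`: the coordinates of `x` outside the support of `σs`. -/
def partF {n : ℕ} (σs : Equiv.Perm (Fin n)) (x : RSpace n) :
    EuclideanSpace ℝ {i : Fin n // i ∉ σs.support} :=
  WithLp.toLp 2 (fun i => x i)

/-- `x^M`: the coordinates of `x` in the support of `σs`. -/
def partM {n : ℕ} (σs : Equiv.Perm (Fin n)) (x : RSpace n) :
    EuclideanSpace ℝ {i : Fin n // i ∈ σs.support} :=
  WithLp.toLp 2 (fun i => x i)

/-- The rectangular neighbourhood `B(a^F, δ₁) ⊗ B(a^M, δ₂)`. -/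
def box {n : ℕ} (σs : Equiv.Perm (Fin n)) (a : RSpace n) (δ₁ δ₂ : ℝ) : Set (RSpace n) :=
  {x | partF σs x ∈ ball (partF σs a) δ₁ ∧ partM σs x ∈ ball (partM σs a) δ₂}

/-- The reduced affine domain
`D = (a + T_M(a) ⊕ (N_M(a) ∩ Δ(σ)^⊥⊥)) ∩ (B(a^F, δ₁) ⊗ B(a^M, δ₂))`. -/
def reducedDomain {n : ℕ} (M : Set (RSpace n)) (σs σ : Equiv.Perm (Fin n)) (a : RSpace n)
    (δ₁ δ₂ : ℝ) : Set (RSpace n) :=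
  {x | x - a ∈ reducedDirection M σ a} ∩ box σs a δ₁ δ₂

/-- The conditions on `δ₁, δ₂`: the rectangular neighbourhood lies in `B(a, δ)`, and `D` is
projected into the domain of the tangential parametrization. -/
structure IsAdmissibleBox {n : ℕ} (M : Set (RSpace n)) (σs σ : Equiv.Perm (Fin n))
    (a : RSpace n) (δ δ₁ δ₂ : ℝ) : Prop where
  pos₁ : 0 < δ₁
  pos₂ : 0 < δ₂
  subset_ball : box σs a δ₁ δ₂ ⊆ ball a δ
  mapsTo : MapsTo (projT M a) (reducedDomain M σs σ a δ₁ δ₂) (paramDomain M a δ)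

/-- The map `φ̄(x) = a + φ(π̄_T(x)) - π̄_N^red(x)`. -/
def phiBar {n : ℕ} (M : Set (RSpace n)) (σ : Equiv.Perm (Fin n)) (a : RSpace n) (δ : ℝ)
    (x : RSpace n) : RSpace n :=
  a + tangDisp M a δ (projT M a x) - projNRed M σ a x

end

/-! The permutations `σ' ≿ σ` are exactly those that fix `a`. They preserve `M` near `a`, hence `T`
and the projection onto `a + T`, so the normal displacement is equivariant: `φ(τp) = τφ(p)`
(`tangDisp_permAct`).

The key point is that `φ` takes values in `N^red` (`tangDisp_apply_eq`). If `a i = a j`, the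
transposition `s` of `i, j` fixes `a`, so `T` is `s`-invariant. Since `v - sv` is a multiple of `e_i
- e_j`, either all of `T` satisfies `v i = v j` or `T` contains `e_i - e_j`. In the first case `s`
fixes `p`, hence also `φ(p)`; in the second, `φ(p) ⊥ e_i - e_j`. Either way `φ(p) i = φ(p) j`.

So near `a` the manifold lies in `a + T ⊕ N^red`, as the graph of `φ`, and `φ̄` compares `φ` with
the reduced normal component. Permutations fixing `a` fix `N^red` pointwise, so equivariance of `φ`
becomes invariance of `φ̄`.

Invariance of `D` also needs these permutations to preserve the support of `σs`. By the same
dichotomy, an identity `x i = x j` holds on `M` near a given point or fails on a dense subset of `M`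
near it. By connectedness the identities valid near a point are the same everywhere on `M`; they are
the cycles of `σs`, and a permutation fixing `a` permutes them. Admissible radii come from the
inverse function theorem. -/

/-! ### The permutation action -/

@[simp] theorem permAct_apply {n : ℕ} (τ : Equiv.Perm (Fin n)) (x : RSpace n) (i : Fin n) :
    permAct τ x i = x (τ⁻¹ i) := rfl

/-- The action of a permutation as a linear isometry. -/
noncomputable def permIsometry {n : ℕ} (τ : Equiv.Perm (Fin n)) : RSpace n ≃ₗᵢ[ℝ] RSpace n :=
  LinearIsometryEquiv.piLpCongrLeft 2 ℝ ℝ τ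

theorem permIsometry_apply {n : ℕ} (τ : Equiv.Perm (Fin n)) (x : RSpace n) :
    permIsometry τ x = permAct τ x := by
  ext i
  simp [permIsometry, LinearIsometryEquiv.piLpCongrLeft_apply, Equiv.piCongrLeft']

theorem permAct_sub {n : ℕ} (τ : Equiv.Perm (Fin n)) (x y : RSpace n) :
    permAct τ (x - y) = permAct τ x - permAct τ y := rfl

theorem permAct_add {n : ℕ} (τ : Equiv.Perm (Fin n)) (x y : RSpace n) :
    permAct τ (x + y) = permAct τ x + permAct τ y := rfl

theorem permAct_inv_permAct {n : ℕ} (τ : Equiv.Perm (Fin n)) (x : RSpace n) :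
    permAct τ⁻¹ (permAct τ x) = x := by
  ext i
  simp only [permAct_apply, inv_inv, ← Equiv.Perm.mul_apply, inv_mul_cancel, Equiv.Perm.one_apply]

theorem permAct_permAct_inv {n : ℕ} (τ : Equiv.Perm (Fin n)) (x : RSpace n) :
    permAct τ (permAct τ⁻¹ x) = x := by
  ext i
  simp only [permAct_apply, inv_inv, ← Equiv.Perm.mul_apply, mul_inv_cancel, Equiv.Perm.one_apply]

theorem permAct_inv_fix {n : ℕ} {τ : Equiv.Perm (Fin n)} {a : RSpace n} (h : permAct τ a = a) :
    permAct τ⁻¹ a = a := by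
  conv_lhs => rw [← h]
  exact permAct_inv_permAct τ a

theorem dist_permAct {n : ℕ} (τ : Equiv.Perm (Fin n)) (x y : RSpace n) :
    dist (permAct τ x) (permAct τ y) = dist x y := by
  simp only [← permIsometry_apply, LinearIsometryEquiv.dist_map]

theorem permAct_mem_ball {n : ℕ} {τ : Equiv.Perm (Fin n)} {a x : RSpace n} {δ : ℝ}
    (h : permAct τ a = a) (hx : x ∈ ball a δ) : permAct τ x ∈ ball a δ := by
  rw [mem_ball] at hx ⊢
  rw [← h, dist_permAct]
  exact hx

/-- The displacement under a transposition always lies on one fixed line; the dichotomy for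
invariant subspaces rests on this. -/
theorem permAct_swap {n : ℕ} (i j : Fin n) (x : RSpace n) :
    x - permAct (Equiv.swap i j) x =
      (x i - x j) • (EuclideanSpace.single i (1 : ℝ) - EuclideanSpace.single j (1 : ℝ)) := by
  ext k
  by_cases hij : i = j
  · subst hij; simp
  rcases eq_or_ne k i with rfl | hki
  · simp [hij]
  rcases eq_or_ne k j with rfl | hkj
  · simp [hki]
  · simp [Equiv.swap_apply_of_ne_of_ne hki hkj, hki, hkj]

theorem permAct_swap_eq_self {n : ℕ} {i j : Fin n} {x : RSpace n} (h : x i = x j) :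
    permAct (Equiv.swap i j) x = x := by
  have := permAct_swap i j x
  rw [h, sub_self, zero_smul, sub_eq_zero] at this
  exact this.symm

theorem eq_of_permAct_swap_eq_self {n : ℕ} {i j : Fin n} {x : RSpace n}
    (h : permAct (Equiv.swap i j) x = x) : x i = x j := by
  conv_lhs => rw [← h]
  simp

/-! ### Strata -/

theorem mem_stratum_iff {n : ℕ} {σ : Equiv.Perm (Fin n)} {a : RSpace n} :
    a ∈ stratum σ ↔ ∀ i j, a i = a j ↔ σ.SameCycle i j := by
  simp only [stratum, mem_ofPred_eq, Setoid.ext_iff]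
  rfl

/-- The level sets of `a` are the cycles of `σ`, and `τ` fixes `a` exactly when `a` is constant
along the cycles of `τ`. The refinement order thus becomes a stabilizer condition. -/
theorem permLE_iff_permAct_eq {n : ℕ} {σ τ : Equiv.Perm (Fin n)} {a : RSpace n}
    (ha : a ∈ stratum σ) : PermLE σ τ ↔ permAct τ a = a := by
  rw [mem_stratum_iff] at ha
  constructor
  · intro h
    ext i
    have : τ.SameCycle (τ⁻¹ i) i := ⟨1, by simp⟩
    exact (ha _ _).2 (h this)
  · intro h i j hij
    obtain ⟨k, rfl⟩ := hij
    refine (ha _ _).1 ?_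
    have step : ∀ l, a (τ l) = a l := fun l => by
      conv_lhs => rw [← h]
      simp
    have stepinv : ∀ l, a (τ⁻¹ l) = a l := fun l => by
      conv_rhs => rw [← h]
      simp
    induction k using Int.induction_on with
    | zero => simp
    | succ m ih =>
      rw [add_comm, zpow_add, zpow_one, Equiv.Perm.mul_apply, step]; exact ih
    | pred m ih =>
      rw [sub_eq_add_neg, add_comm, zpow_add, zpow_neg_one, Equiv.Perm.mul_apply, stepinv]
      exact ih

/-- Finitely many inequalities `a i ≠ a j` persist nearby, so the partition of a point can only
become finer under small perturbations. -/
theorem eventually_eq_imp_eq {n : ℕ} (a : RSpace n) :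
    ∀ᶠ y in 𝓝 a, ∀ i j, y i = y j → a i = a j := by
  refine eventually_all.2 fun i => eventually_all.2 fun j => ?_
  by_cases h : a i = a j
  · exact Eventually.of_forall fun _ _ => h
  · have hi : Continuous fun y : RSpace n => y i := by fun_prop
    have hj : Continuous fun y : RSpace n => y j := by fun_prop
    filter_upwards [(isOpen_ne_fun hi hj).eventually_mem h] with y hy hy'
    exact absurd hy' hy

/-- The double orthogonal is the span of the stratum. If `x` has the coordinate identities of `a`,
then `a + t • x` stays in the stratum for small `t ≠ 0`, so `x` is a multiple of a difference of two
points of the stratum. -/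
theorem mem_stratumBiperp_iff {n : ℕ} {σ : Equiv.Perm (Fin n)} {a : RSpace n}
    (ha : a ∈ stratum σ) {x : RSpace n} :
    x ∈ stratumBiperp σ ↔ ∀ i j, a i = a j → x i = x j := by
  rw [stratumBiperp, stratumPerp, Submodule.orthogonal_orthogonal]
  constructor
  · intro hx i j hij
    induction hx using Submodule.span_induction with
    | mem y hy => exact (mem_stratum_iff.1 hy i j).2 ((mem_stratum_iff.1 ha i j).1 hij)
    | zero => rfl
    | add y z _ _ hy hz => simp [hy, hz]
    | smul c y _ hy => simp [hy]
  · intro hx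
    have hc : Tendsto (fun t : ℝ => a + t • x) (𝓝[≠] 0) (𝓝 a) := by
      have : Continuous fun t : ℝ => a + t • x := by fun_prop
      simpa using (this.tendsto 0).mono_left nhdsWithin_le_nhds
    obtain ⟨t, ht, ht0⟩ :=
      ((hc.eventually (eventually_eq_imp_eq a)).and eventually_mem_nhdsWithin).exists
    have ht0 : t ≠ 0 := ht0
    have hmem : a + t • x ∈ stratum σ := by
      rw [mem_stratum_iff]
      intro i j
      rw [← mem_stratum_iff.1 ha i j]
      refine ⟨ht i j, fun h => ?_⟩
      simp [h, hx i j h]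
    have hxe : x = t⁻¹ • ((a + t • x) - a) := by
      rw [add_sub_cancel_left, smul_smul, inv_mul_cancel₀ ht0, one_smul]
    rw [hxe]
    exact Submodule.smul_mem _ _
      (Submodule.sub_mem _ (Submodule.subset_span hmem) (Submodule.subset_span ha))

theorem permAct_eq_of_mem_stratumBiperp {n : ℕ} {σ τ : Equiv.Perm (Fin n)} {a x : RSpace n}
    (ha : a ∈ stratum σ) (hτ : permAct τ a = a) (hx : x ∈ stratumBiperp σ) :
    permAct τ x = x := by
  ext i
  refine (mem_stratumBiperp_iff ha).1 hx _ _ ?_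
  conv_rhs => rw [← hτ]
  simp

/-! ### Invariant subspaces -/

/-- Invariance under `τ` puts the candidate in `V`; invariance under `τ⁻¹` gives orthogonality of
the remainder, by moving `τ` across the inner product. -/
theorem starProjection_permAct {n : ℕ} {V : Submodule ℝ (RSpace n)} {τ : Equiv.Perm (Fin n)}
    (h : ∀ v ∈ V, permAct τ v ∈ V) (h' : ∀ v ∈ V, permAct τ⁻¹ v ∈ V) (x : RSpace n) :
    V.starProjection (permAct τ x) = permAct τ (V.starProjection x) := by
  refine (Submodule.eq_starProjection_of_mem_orthogonal
    (h _ (Submodule.starProjection_apply_mem V x)) ?_)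
  rw [Submodule.mem_orthogonal]
  intro u hu
  have := (Submodule.mem_orthogonal _ _).1 (Submodule.sub_starProjection_mem_orthogonal
    (K := V) x) _ (h' u hu)
  rw [← permAct_sub, ← permIsometry_apply,
    ← permAct_permAct_inv τ u, ← permIsometry_apply τ (permAct τ⁻¹ u),
    LinearIsometryEquiv.inner_map_map]
  exact this

/-- A subspace invariant under the transposition of `i` and `j` either lies in the hyperplane
`x_i = x_j` or contains the difference of the two basis vectors. -/
theorem forall_eq_or_single_sub_single_mem {n : ℕ} {V : Submodule ℝ (RSpace n)} {i j : Fin n}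
    (h : ∀ v ∈ V, permAct (Equiv.swap i j) v ∈ V) :
    (∀ v ∈ V, v i = v j) ∨
      EuclideanSpace.single i (1 : ℝ) - EuclideanSpace.single j (1 : ℝ) ∈ V := by
  by_contra! hcon
  obtain ⟨⟨v, hv, hne⟩, hnot⟩ := hcon
  have hmem := V.sub_mem hv (h v hv)
  rw [permAct_swap, V.smul_mem_iff (sub_ne_zero.2 hne)] at hmem
  exact hnot hmem

theorem eq_of_mem_orthogonal {n : ℕ} {V : Submodule ℝ (RSpace n)} {i j : Fin n}
    (h : EuclideanSpace.single i (1 : ℝ) - EuclideanSpace.single j (1 : ℝ) ∈ V)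
    {x : RSpace n} (hx : x ∈ Vᗮ) : x i = x j := by
  have := (Submodule.mem_orthogonal _ _).1 hx _ h
  rw [inner_sub_left, EuclideanSpace.inner_single_left, EuclideanSpace.inner_single_left] at this
  simpa [sub_eq_zero] using this

/-! ### Invariance of the tangent space -/

theorem permAct_mem_of_fix {n : ℕ} {M : Set (RSpace n)} {a : RSpace n} {δ : ℝ} (hδ : 0 < δ)
    (haM : a ∈ M) (hS : IsStronglySymmetric (M ∩ ball a δ)) {τ : Equiv.Perm (Fin n)}
    (hτ : permAct τ a = a) {x : RSpace n} (hx : x ∈ M ∩ ball a δ) :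
    permAct τ x ∈ M ∩ ball a δ := by
  rw [← hS a ⟨haM, mem_ball_self hδ⟩ τ hτ]
  exact mem_image_of_mem _ hx

/-- Permuting a curve in `M` through `a` gives another such curve: by continuity it stays in the
symmetric ball for small times, which is all the definition of velocity asks. -/
theorem permAct_mem_tangentSpaceAt {n : ℕ} {M : Set (RSpace n)} {a : RSpace n} {δ : ℝ}
    (hδ : 0 < δ) (haM : a ∈ M) (hS : IsStronglySymmetric (M ∩ ball a δ))
    {τ : Equiv.Perm (Fin n)} (hτ : permAct τ a = a) {v : RSpace n}
    (hv : v ∈ tangentSpaceAt M a) : permAct τ v ∈ tangentSpaceAt M a := by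
  induction hv using Submodule.span_induction with
  | mem v hv =>
    obtain ⟨γ, hγ, h0, hev, hd⟩ := hv
    refine Submodule.subset_span ⟨fun t => permIsometry τ (γ t), ?_, ?_, ?_, ?_⟩
    · exact (permIsometry τ).toContinuousLinearEquiv.contDiff.contDiffAt.comp _ hγ
    · simp only [permIsometry_apply]; rw [h0, hτ]
    · have hc : ∀ᶠ t in 𝓝 (0 : ℝ), γ t ∈ ball a δ :=
        hγ.continuousAt.eventually_mem (by rw [h0]; exact ball_mem_nhds _ hδ)
      filter_upwards [hev, hc] with t h1 h2
      rw [permIsometry_apply]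
      exact (permAct_mem_of_fix hδ haM hS hτ ⟨h1, h2⟩).1
    · have := (permIsometry τ).toContinuousLinearEquiv.toContinuousLinearMap.hasFDerivAt
        (x := γ 0) |>.comp_hasDerivAt 0 (hγ.differentiableAt one_ne_zero).hasDerivAt
      rw [hd] at this
      exact this.deriv.trans (permIsometry_apply τ v)
  | zero => exact Submodule.zero_mem _
  | add x y _ _ hx hy => rw [permAct_add]; exact Submodule.add_mem _ hx hy
  | smul c x _ hx =>
    rw [← permIsometry_apply] at hx ⊢
    rw [map_smul]
    exact Submodule.smul_mem _ _ hx

/-! ### The tangential parametrization -/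

/-- The part of the admissibility of a radius that does not refer to strata. -/
structure IsParamRadius {n : ℕ} (M : Set (RSpace n)) (a : RSpace n) (δ : ℝ) : Prop where
  pos : 0 < δ
  symmetric : IsStronglySymmetric (M ∩ ball a δ)
  injOn : InjOn (projT M a) (M ∩ ball a δ)
  isOpen : IsOpen {u : tangentSpaceAt M a | a + (u : RSpace n) ∈ paramDomain M a δ}
  contDiffOn : ContDiffOn ℝ 2 (fun u : tangentSpaceAt M a => tangParam M a δ (a + (u : RSpace n)))
    {u : tangentSpaceAt M a | a + (u : RSpace n) ∈ paramDomain M a δ}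

theorem IsAdmissibleRadius.isParamRadius {n : ℕ} {M : Set (RSpace n)} {σ : Equiv.Perm (Fin n)}
    {a : RSpace n} {δ : ℝ} (h : IsAdmissibleRadius M σ a δ) : IsParamRadius M a δ :=
  ⟨h.pos, h.symmetric, h.injOn, h.isOpen, h.contDiffOn⟩

theorem projT_sub {n : ℕ} (M : Set (RSpace n)) (a x : RSpace n) :
    projT M a x - a = (tangentSpaceAt M a).starProjection (x - a) := by
  simp [projT, affProj]

theorem projT_add {n : ℕ} (M : Set (RSpace n)) (a v : RSpace n) :
    projT M a (a + v) = a + (tangentSpaceAt M a).starProjection v := by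
  simp [projT, affProj]

theorem projT_self {n : ℕ} (M : Set (RSpace n)) (a : RSpace n) : projT M a a = a := by
  simp [projT, affProj]

theorem projT_permAct {n : ℕ} {M : Set (RSpace n)} {a : RSpace n} {δ : ℝ} (hδ : 0 < δ)
    (haM : a ∈ M) (hS : IsStronglySymmetric (M ∩ ball a δ)) {τ : Equiv.Perm (Fin n)}
    (hτ : permAct τ a = a) (x : RSpace n) :
    projT M a (permAct τ x) = permAct τ (projT M a x) := by
  rw [projT, affProj, projT, affProj, permAct_add, hτ, ← starProjection_permAct
    (fun v hv => permAct_mem_tangentSpaceAt hδ haM hS hτ hv)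
    (fun v hv => permAct_mem_tangentSpaceAt hδ haM hS (permAct_inv_fix hτ) hv), permAct_sub, hτ]

theorem tangParam_mem {n : ℕ} {M : Set (RSpace n)} {a p : RSpace n} {δ : ℝ}
    (hp : p ∈ paramDomain M a δ) : tangParam M a δ p ∈ M ∩ ball a δ :=
  Function.invFunOn_mem hp

theorem projT_tangParam {n : ℕ} {M : Set (RSpace n)} {a p : RSpace n} {δ : ℝ}
    (hp : p ∈ paramDomain M a δ) : projT M a (tangParam M a δ p) = p :=
  Function.invFunOn_eq hp

theorem tangDisp_mem_normalSpaceAt {n : ℕ} {M : Set (RSpace n)} {a p : RSpace n} {δ : ℝ}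
    (hp : p ∈ paramDomain M a δ) : tangDisp M a δ p ∈ normalSpaceAt M a := by
  have h := projT_sub M a (tangParam M a δ p)
  rw [projT_tangParam hp] at h
  have : tangDisp M a δ p = (tangParam M a δ p - a) -
      (tangentSpaceAt M a).starProjection (tangParam M a δ p - a) := by
    rw [← h, tangDisp]; abel
  rw [this]
  exact Submodule.sub_starProjection_mem_orthogonal _

theorem projT_sub_mem {n : ℕ} (M : Set (RSpace n)) (a x : RSpace n) :
    projT M a x - a ∈ tangentSpaceAt M a := by
  rw [projT_sub]
  exact Submodule.starProjection_apply_mem _ _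

theorem sub_mem_of_mem_paramDomain {n : ℕ} {M : Set (RSpace n)} {a p : RSpace n} {δ : ℝ}
    (hp : p ∈ paramDomain M a δ) : p - a ∈ tangentSpaceAt M a := by
  rw [← projT_tangParam hp]
  exact projT_sub_mem M a _

namespace IsParamRadius

variable {n : ℕ} {M : Set (RSpace n)} {a : RSpace n} {δ : ℝ}

theorem tangParam_projT (h : IsParamRadius M a δ) {x : RSpace n} (hx : x ∈ M ∩ ball a δ) :
    tangParam M a δ (projT M a x) = x :=
  h.injOn.leftInvOn_invFunOn hx

theorem mem_paramDomain_self (h : IsParamRadius M a δ) (haM : a ∈ M) :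
    a ∈ paramDomain M a δ :=
  ⟨a, ⟨haM, mem_ball_self h.pos⟩, projT_self M a⟩

theorem tangDisp_self (h : IsParamRadius M a δ) (haM : a ∈ M) : tangDisp M a δ a = 0 := by
  have := h.tangParam_projT ⟨haM, mem_ball_self h.pos⟩
  rw [projT_self] at this
  rw [tangDisp, this, sub_self]

/-- The permuted point of `M` lies in the same ball and projects to `permAct τ p`; injectivity of
the projection identifies it with the parametrized point there. -/
theorem tangDisp_permAct (h : IsParamRadius M a δ) (haM : a ∈ M)
    {τ : Equiv.Perm (Fin n)} (hτ : permAct τ a = a) {p : RSpace n}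
    (hp : p ∈ paramDomain M a δ) :
    tangDisp M a δ (permAct τ p) = permAct τ (tangDisp M a δ p) := by
  have key := h.tangParam_projT
    (permAct_mem_of_fix h.pos haM h.symmetric hτ (tangParam_mem hp))
  rw [projT_permAct h.pos haM h.symmetric hτ, projT_tangParam hp] at key
  rw [tangDisp, key, tangDisp, permAct_sub]

/-- The normal displacement has equal coordinates wherever the base point has. -/
theorem tangDisp_apply_eq (h : IsParamRadius M a δ) (haM : a ∈ M) {p : RSpace n}
    (hp : p ∈ paramDomain M a δ) {i j : Fin n} (hij : a i = a j) :
    tangDisp M a δ p i = tangDisp M a δ p j := by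
  have hfix := permAct_swap_eq_self hij
  rcases forall_eq_or_single_sub_single_mem fun v hv =>
    permAct_mem_tangentSpaceAt h.pos haM h.symmetric hfix hv with hT | hT
  · have hp' := hT _ (sub_mem_of_mem_paramDomain hp)
    have hpij : p i = p j := by simpa [hij] using hp'
    apply eq_of_permAct_swap_eq_self
    rw [← h.tangDisp_permAct haM hfix hp, permAct_swap_eq_self hpij]
  · exact eq_of_mem_orthogonal hT (tangDisp_mem_normalSpaceAt hp)

theorem tangDisp_mem_reducedNormal (h : IsParamRadius M a δ) (haM : a ∈ M)
    {σ : Equiv.Perm (Fin n)} (haσ : a ∈ stratum σ) {p : RSpace n}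
    (hp : p ∈ paramDomain M a δ) : tangDisp M a δ p ∈ reducedNormal M σ a :=
  ⟨tangDisp_mem_normalSpaceAt hp,
    (mem_stratumBiperp_iff haσ).2 fun _ _ => h.tangDisp_apply_eq haM hp⟩

/-- Near each of its points, `M` either satisfies `x_i = x_j` identically, or violates it on a
dense subset. -/
theorem eventually_eq_or_frequently_ne (h : IsParamRadius M a δ) (haM : a ∈ M) (i j : Fin n) :
    (∀ᶠ x in 𝓝 a, x ∈ M → x i = x j) ∨
      ∀ᶠ x in 𝓝 a, x ∈ M → ∃ᶠ y in 𝓝 x, y ∈ M ∧ y i ≠ y j := by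
  rcases eq_or_ne i j with rfl | hne
  · exact Or.inl (Eventually.of_forall fun _ _ => rfl)
  by_cases hij : a i = a j
  swap
  · right
    filter_upwards [eventually_eq_imp_eq a] with x hx hxM hev
    exact hev.self_of_nhds ⟨hxM, fun hc => hij (hx i j hc)⟩
  -- Neither `a` nor the displacement contributes to `x i - x j`, so on `M` this difference is a
  -- linear function of the tangential coordinate.
  have hdisp : ∀ x ∈ M ∩ ball a δ,
      x i - x j = (projT M a x - a) i - (projT M a x - a) j := by
    intro x hx
    have h1 := h.tangDisp_apply_eq haM (mem_image_of_mem (projT M a) hx) hij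
    rw [tangDisp, h.tangParam_projT hx] at h1
    simp only [PiLp.sub_apply] at h1 ⊢
    linarith
  have hfix := permAct_swap_eq_self hij
  rcases forall_eq_or_single_sub_single_mem fun v hv =>
    permAct_mem_tangentSpaceAt h.pos haM h.symmetric hfix hv with hT | hT
  · left
    filter_upwards [ball_mem_nhds a h.pos] with x hx hxM
    have := hdisp x ⟨hxM, hx⟩
    rw [hT _ (projT_sub_mem M a x), sub_self] at this
    exact sub_eq_zero.1 this
  · right
    filter_upwards [ball_mem_nhds a h.pos] with x hx hxM
    by_cases hxij : x i = x j
    swap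
    · exact fun hev => hev.self_of_nhds ⟨hxM, hxij⟩
    -- Moving the tangential coordinate by `t` along `e_i - e_j` changes the difference of the two
    -- coordinates from `0` to `2t`; the points of `M` above it tend to `x`.
    let w : tangentSpaceAt M a := ⟨_, hT⟩
    let u : tangentSpaceAt M a := ⟨_, projT_sub_mem M a x⟩
    have hau : a + (u : RSpace n) = projT M a x := by simp [u]
    have huS : u ∈ {u : tangentSpaceAt M a | a + (u : RSpace n) ∈ paramDomain M a δ} := by
      change a + (u : RSpace n) ∈ paramDomain M a δ
      rw [hau]
      exact mem_image_of_mem _ ⟨hxM, hx⟩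
    have hline : Tendsto (fun t : ℝ => u + t • w) (𝓝[≠] 0) (𝓝 u) := by
      have hc : Continuous fun t : ℝ => u + t • w := by fun_prop
      simpa using (hc.tendsto 0).mono_left nhdsWithin_le_nhds
    have hmem := hline.eventually (h.isOpen.eventually_mem huS)
    have hlim : Tendsto (fun t : ℝ => tangParam M a δ (a + ((u + t • w : tangentSpaceAt M a) :
        RSpace n))) (𝓝[≠] 0) (𝓝 x) := by
      have hca := (h.contDiffOn.continuousOn.continuousAt (h.isOpen.mem_nhds huS)).tendsto
      rw [hau, h.tangParam_projT ⟨hxM, hx⟩] at hca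
      exact hca.comp hline
    refine hlim.frequently (Eventually.frequently ?_)
    filter_upwards [hmem, eventually_mem_nhdsWithin] with t ht ht0
    have ht : a + ((u + t • w : tangentSpaceAt M a) : RSpace n) ∈ paramDomain M a δ := ht
    have ht0 : t ≠ 0 := ht0
    refine ⟨(tangParam_mem ht).1, ?_⟩
    have h2 := hdisp _ (tangParam_mem ht)
    rw [projT_tangParam ht, add_sub_cancel_left] at h2
    have h1 := hdisp x ⟨hxM, hx⟩
    rw [hxij, sub_self] at h1
    rw [← sub_ne_zero, h2]
    simp [u, w, hne, hne.symm] at h1 ⊢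
    intro hc
    apply ht0
    linarith

end IsParamRadius

/-- On a connected `M`, a coordinate identity that holds near one point of `M` holds near all. -/
theorem eventually_eq_of_eventually_eq {n : ℕ} {M : Set (RSpace n)} (hM : IsPreconnected M)
    (hr : ∀ b ∈ M, ∃ δ, IsParamRadius M b δ) {i j : Fin n} {b c : RSpace n} (hb : b ∈ M)
    (hc : c ∈ M) (h : ∀ᶠ x in 𝓝 b, x ∈ M → x i = x j) : ∀ᶠ x in 𝓝 c, x ∈ M → x i = x j := by
  have : PreconnectedSpace M := isPreconnected_iff_preconnectedSpace.1 hM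
  let A : Set M := {z | ∀ᶠ x in 𝓝 (z : RSpace n), x ∈ M → x i = x j}
  have hopen : IsOpen {z : RSpace n | ∀ᶠ x in 𝓝 z, x ∈ M → x i = x j} :=
    isOpen_setOfPred_eventually_nhds
  have hA : IsClopen A := by
    refine ⟨⟨isOpen_iff_mem_nhds.2 fun z hz => ?_⟩, hopen.preimage continuous_subtype_val⟩
    obtain ⟨δ, hδ⟩ := hr z z.2
    -- Closedness of `A`: if the identity does not hold near `z`, then every point of `M` near `z`
    -- is a limit of violations in `M`, so none of them lies in `A`.
    have h1 := (hδ.eventually_eq_or_frequently_ne z.2 i j).resolve_left hz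
    filter_upwards [continuous_subtype_val.continuousAt.eventually h1] with y hy hyA
    exact hy y.2 (hyA.mono fun x hx hx' => hx'.2 (hx hx'.1))
  have := hA.eq_univ ⟨⟨b, hb⟩, h⟩
  exact (this ▸ mem_univ _ : (⟨c, hc⟩ : M) ∈ A)

/-- The cycles of a characteristic permutation are the coordinate identities valid near any
given point of `M`. -/
theorem IsCharacteristic.sameCycle_iff {n : ℕ} {M : Set (RSpace n)} {σs : Equiv.Perm (Fin n)}
    (hσs : IsCharacteristic M σs) (hM : IsPreconnected M)
    (hr : ∀ b ∈ M, ∃ δ, IsParamRadius M b δ) {a : RSpace n} (ha : a ∈ M) (i j : Fin n) :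
    σs.SameCycle i j ↔ ∀ᶠ x in 𝓝 a, x ∈ M → x i = x j := by
  obtain ⟨b, hb, ρ, hρ, hsub⟩ := hσs
  constructor
  · intro h
    refine eventually_eq_of_eventually_eq hM hr hb ha ?_
    filter_upwards [ball_mem_nhds b hρ] with x hx hxM
    exact (mem_stratum_iff.1 (hsub ⟨hxM, hx⟩) i j).2 h
  · intro h
    exact (mem_stratum_iff.1 (hsub ⟨hb, mem_ball_self hρ⟩) i j).1
      ((eventually_eq_of_eventually_eq hM hr ha hb h).self_of_nhds hb)

theorem mem_support_iff_exists_sameCycle {n : ℕ} (τ : Equiv.Perm (Fin n)) (i : Fin n) :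
    i ∈ τ.support ↔ ∃ j, j ≠ i ∧ τ.SameCycle i j := by
  rw [Equiv.Perm.mem_support]
  constructor
  · intro h
    exact ⟨τ i, h, ⟨1, by simp⟩⟩
  · rintro ⟨j, hji, hij⟩ hfix
    exact hji (hij.eq_of_left hfix).symm

/-- The permutations fixing a point of `M` preserve the support of a characteristic
permutation. -/
theorem IsCharacteristic.apply_mem_support {n : ℕ} {M : Set (RSpace n)}
    {σs : Equiv.Perm (Fin n)} (hσs : IsCharacteristic M σs) (hM : IsPreconnected M)
    (hr : ∀ b ∈ M, ∃ δ, IsParamRadius M b δ) {a : RSpace n} (ha : a ∈ M)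
    {τ : Equiv.Perm (Fin n)} (hτ : permAct τ a = a) {i : Fin n} (hi : i ∈ σs.support) :
    τ i ∈ σs.support := by
  rw [mem_support_iff_exists_sameCycle] at hi ⊢
  obtain ⟨j, hji, hij⟩ := hi
  refine ⟨τ j, fun h => hji (τ.injective h), ?_⟩
  rw [hσs.sameCycle_iff hM hr ha] at hij ⊢
  obtain ⟨δ, hδ⟩ := hr a ha
  have hinv := permAct_inv_fix hτ
  have hcont : Tendsto (permAct τ⁻¹) (𝓝 a) (𝓝 a) := by
    have := (permIsometry τ⁻¹).continuous.tendsto a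
    rw [permIsometry_apply, hinv] at this
    exact this.congr (permIsometry_apply τ⁻¹)
  -- The identity for `i, j` is applied to `permAct τ⁻¹ x`, whose coordinates at `i, j` are those of
  -- `x` at `τ i, τ j`.
  filter_upwards [hcont.eventually hij, ball_mem_nhds a hδ.pos] with x hx hxb hxM
  have := hx (permAct_mem_of_fix hδ.pos ha hδ.symmetric hinv ⟨hxM, hxb⟩).1
  simpa only [permAct_apply, inv_inv] using this

theorem IsCharacteristic.apply_mem_support_iff {n : ℕ} {M : Set (RSpace n)}
    {σs : Equiv.Perm (Fin n)} (hσs : IsCharacteristic M σs) (hM : IsPreconnected M)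
    (hr : ∀ b ∈ M, ∃ δ, IsParamRadius M b δ) {a : RSpace n} (ha : a ∈ M)
    {τ : Equiv.Perm (Fin n)} (hτ : permAct τ a = a) (i : Fin n) :
    τ i ∈ σs.support ↔ i ∈ σs.support := by
  refine ⟨fun h => ?_, hσs.apply_mem_support hM hr ha hτ⟩
  simpa using hσs.apply_mem_support hM hr ha (permAct_inv_fix hτ) h

/-! ### The rectangular neighbourhoods -/

theorem norm_partF_permAct {n : ℕ} {σs τ : Equiv.Perm (Fin n)}
    (h : ∀ i, τ i ∈ σs.support ↔ i ∈ σs.support) (x : RSpace n) :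
    ‖partF σs (permAct τ x)‖ = ‖partF σs x‖ := by
  rw [EuclideanSpace.norm_eq, EuclideanSpace.norm_eq]
  congr 1
  refine (Fintype.sum_equiv (τ.subtypeEquiv fun i => (h i).not.symm) _ _ fun i => ?_).symm
  simp [partF]

theorem norm_partM_permAct {n : ℕ} {σs τ : Equiv.Perm (Fin n)}
    (h : ∀ i, τ i ∈ σs.support ↔ i ∈ σs.support) (x : RSpace n) :
    ‖partM σs (permAct τ x)‖ = ‖partM σs x‖ := by
  rw [EuclideanSpace.norm_eq, EuclideanSpace.norm_eq]
  congr 1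
  refine (Fintype.sum_equiv (τ.subtypeEquiv fun i => (h i).symm) _ _ fun i => ?_).symm
  simp [partM]

theorem mem_box_iff {n : ℕ} {σs : Equiv.Perm (Fin n)} {a x : RSpace n} {δ₁ δ₂ : ℝ} :
    x ∈ box σs a δ₁ δ₂ ↔ ‖partF σs (x - a)‖ < δ₁ ∧ ‖partM σs (x - a)‖ < δ₂ := by
  rw [box, mem_ofPred_eq, mem_ball_iff_norm, mem_ball_iff_norm]
  rfl

theorem permAct_mem_box {n : ℕ} {σs τ : Equiv.Perm (Fin n)}
    (h : ∀ i, τ i ∈ σs.support ↔ i ∈ σs.support) {a x : RSpace n} (hτ : permAct τ a = a)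
    {δ₁ δ₂ : ℝ} (hx : x ∈ box σs a δ₁ δ₂) : permAct τ x ∈ box σs a δ₁ δ₂ := by
  rw [mem_box_iff] at hx ⊢
  have : permAct τ x - a = permAct τ (x - a) := by rw [permAct_sub, hτ]
  rwa [this, norm_partF_permAct h, norm_partM_permAct h]

theorem continuous_partF {n : ℕ} (σs : Equiv.Perm (Fin n)) : Continuous (partF σs) := by
  unfold partF
  fun_prop

theorem continuous_partM {n : ℕ} (σs : Equiv.Perm (Fin n)) : Continuous (partM σs) := by
  unfold partM
  fun_prop

theorem isOpen_box {n : ℕ} (σs : Equiv.Perm (Fin n)) (a : RSpace n) (δ₁ δ₂ : ℝ) :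
    IsOpen (box σs a δ₁ δ₂) :=
  (isOpen_ball.preimage (continuous_partF σs)).inter (isOpen_ball.preimage (continuous_partM σs))

theorem norm_sq_eq_partF_add_partM {n : ℕ} (σs : Equiv.Perm (Fin n)) (x : RSpace n) :
    ‖x‖ ^ 2 = ‖partF σs x‖ ^ 2 + ‖partM σs x‖ ^ 2 := by
  rw [EuclideanSpace.norm_sq_eq, EuclideanSpace.norm_sq_eq, EuclideanSpace.norm_sq_eq, add_comm]
  convert (Fintype.sum_subtype_add_sum_subtype (fun i => i ∈ σs.support)
    fun i => ‖x i‖ ^ 2).symm using 3 <;> first | rfl | (ext; simp)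

theorem norm_le_partF_add_partM {n : ℕ} (σs : Equiv.Perm (Fin n)) (x : RSpace n) :
    ‖x‖ ≤ ‖partF σs x‖ + ‖partM σs x‖ := by
  refine le_of_sq_le_sq ?_ (by positivity)
  nlinarith [norm_sq_eq_partF_add_partM σs x, norm_nonneg (partF σs x), norm_nonneg (partM σs x)]

/-! ### Existence of tangential parametrizations -/

/-- Around each point, a `C²` submanifold is straightened by a local homeomorphism whose first
component is the projection to the tangent space. -/
theorem IsSubmanifold.exists_straightening {n d : ℕ} {M : Set (RSpace n)}
    (hM : IsSubmanifold 2 d M) {a : RSpace n} (ha : a ∈ M) :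
    ∃ Φ : OpenPartialHomeomorph (RSpace n)
        (tangentSpaceAt M a × EuclideanSpace ℝ (Fin (n - d))),
      a ∈ Φ.source ∧ (∀ x, (Φ x).1 = (tangentSpaceAt M a).orthogonalProjectionOnto (x - a)) ∧
        (∀ᶠ x in 𝓝 a, x ∈ M ↔ (Φ x).2 = 0) ∧ ContDiffAt ℝ 2 Φ.symm (Φ a) := by
  obtain ⟨U, hU, haU, f, hf, hsurj, hfM⟩ := hM.2.2 a ha
  have hfa : ContDiffAt ℝ 2 f a := hf.contDiffAt (hU.mem_nhds haU)
  have hf' : HasFDerivAt f (fderiv ℝ f a) a := (hfa.differentiableAt two_ne_zero).hasFDerivAt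
  -- The chart is built over the kernel of the differential. That this kernel is the tangent space
  -- (`hTK`) comes afterwards, since producing enough curves needs the chart.
  obtain ⟨K, hK⟩ : ∃ K : Submodule ℝ (RSpace n), K = (fderiv ℝ f a).ker := ⟨_, rfl⟩
  have hmemK : ∀ v, v ∈ K ↔ fderiv ℝ f a v = 0 := fun v => by rw [hK]; rfl
  have hf0 : f a = 0 := (hfM a haU).1 ha
  let L : RSpace n →L[ℝ] K × EuclideanSpace ℝ (Fin (n - d)) :=
    K.orthogonalProjectionOnto.prod (fderiv ℝ f a)
  have hLinj : L.ker = ⊥ := by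
    rw [LinearMap.ker_eq_bot']
    intro v hv
    have hv : L v = 0 := hv
    have h1 : K.orthogonalProjectionOnto v = 0 := congrArg Prod.fst hv
    have h2 : v ∈ K := (hmemK v).2 (congrArg Prod.snd hv)
    have := Submodule.orthogonalProjectionOnto_mem_subspace_eq_self (⟨v, h2⟩ : K)
    rw [h1] at this
    exact (congrArg Subtype.val this).symm
  have hLsurj : L.range = ⊤ := by
    rw [LinearMap.range_eq_top]
    rintro ⟨u, y⟩
    obtain ⟨x, hx⟩ := hsurj y
    let k : K := u - K.orthogonalProjectionOnto x
    refine ⟨x + k, ?_⟩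
    have hk : fderiv ℝ f a k = 0 := (hmemK _).1 k.2
    apply Prod.ext
    · change K.orthogonalProjectionOnto (x + k) = u
      rw [map_add, Submodule.orthogonalProjectionOnto_mem_subspace_eq_self]
      simp [k]
    · change fderiv ℝ f a (x + k) = y
      rw [map_add, hk, hx, add_zero]
  let L' := ContinuousLinearEquiv.ofBijective L hLinj hLsurj
  let F : RSpace n → K × EuclideanSpace ℝ (Fin (n - d)) :=
    fun x => (K.orthogonalProjectionOnto (x - a), f x)
  have hF : ContDiffAt ℝ 2 F a :=
    (K.orthogonalProjectionOnto.contDiff.contDiffAt.comp a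
      (contDiffAt_id.sub contDiffAt_const)).prodMk hfa
  have hF' : HasFDerivAt F (L' : RSpace n →L[ℝ] K × EuclideanSpace ℝ (Fin (n - d))) a := by
    have h1 : HasFDerivAt (fun x => K.orthogonalProjectionOnto (x - a)) K.orthogonalProjectionOnto a := by
      have := K.orthogonalProjectionOnto.hasFDerivAt.comp a ((hasFDerivAt_id a).sub_const a)
      rw [ContinuousLinearMap.comp_id] at this
      exact this
    have hL' : (L' : RSpace n →L[ℝ] K × EuclideanSpace ℝ (Fin (n - d))) = L :=
      ContinuousLinearMap.ext fun _ => rfl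
    rw [hL']
    exact h1.prodMk hf'
  let Φ := hF.toOpenPartialHomeomorph F hF' two_ne_zero
  have hsrc : a ∈ Φ.source := hF.mem_toOpenPartialHomeomorph_source hF' two_ne_zero
  have hsymm : ContDiffAt ℝ 2 Φ.symm (Φ a) := hF.to_localInverse hF' two_ne_zero
  have hiff : ∀ᶠ x in 𝓝 a, x ∈ M ↔ (Φ x).2 = 0 := by
    filter_upwards [hU.mem_nhds haU] with x hx
    exact hfM x hx
  have hΦa : Φ a = (0, 0) := by
    change F a = _
    simp [F, hf0]
  have hTK : tangentSpaceAt M a = K := by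
    apply le_antisymm
    · refine Submodule.span_le.2 ?_
      rintro v ⟨γ, hγ, h0, hev, hd⟩
      rw [SetLike.mem_coe, hmemK]
      have hγ' := (hγ.differentiableAt one_ne_zero).hasDerivAt
      rw [hd] at hγ'
      have hcomp : HasDerivAt (f ∘ γ) (fderiv ℝ f a v) 0 := by
        rw [← h0] at hf'
        have := hf'.comp_hasDerivAt 0 hγ'
        rwa [h0] at this
      have hzero : f ∘ γ =ᶠ[𝓝 0] fun _ => 0 := by
        filter_upwards [hev, hγ.continuousAt.eventually_mem
          (by rw [h0]; exact hU.mem_nhds haU)] with t h1 h2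
        exact (hfM _ h2).1 h1
      exact hcomp.unique ((hasDerivAt_const 0 _).congr_of_eventuallyEq hzero)
    · intro v hv
      -- A straight line in the slice `K × {0}`; its preimage under the chart is a curve in `M` with
      -- velocity `v`, because the differential of the chart sends `v` to `(v, 0)`.
      let c : ℝ → K × EuclideanSpace ℝ (Fin (n - d)) := fun t => (t • (⟨v, hv⟩ : K), 0)
      have hc0 : c 0 = Φ a := by simp [c, hΦa]
      have hc : ContDiff ℝ 1 c := by fun_prop
      have hc' : HasDerivAt c (⟨v, hv⟩, 0) 0 := by
        have := ((hasDerivAt_id (0 : ℝ)).smul_const (⟨v, hv⟩ : K)).prodMk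
          (hasDerivAt_const (0 : ℝ) (0 : EuclideanSpace ℝ (Fin (n - d))))
        rw [one_smul] at this
        exact this
      have hΦ' : HasFDerivAt Φ.symm
          (L'.symm : K × EuclideanSpace ℝ (Fin (n - d)) →L[ℝ] RSpace n) (c 0) := by
        rw [hc0]
        refine Φ.hasFDerivAt_symm (Φ.map_source hsrc) ?_
        rw [Φ.left_inv hsrc]
        exact hF'
      refine Submodule.subset_span ⟨Φ.symm ∘ c, ?_, ?_, ?_, ?_⟩
      · refine ContDiffAt.comp 0 ?_ hc.contDiffAt
        rw [hc0]
        exact hsymm.of_le one_le_two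
      · rw [Function.comp_apply, hc0, Φ.left_inv hsrc]
      · have htend : Tendsto c (𝓝 0) (𝓝 (Φ a)) := hc0 ▸ hc.continuous.tendsto 0
        have htend' : Tendsto (Φ.symm ∘ c) (𝓝 0) (𝓝 a) := by
          have := (Φ.continuousAt_symm (Φ.map_source hsrc)).tendsto
          rw [Φ.left_inv hsrc] at this
          exact this.comp htend
        filter_upwards [htend'.eventually hiff,
          htend.eventually (Φ.open_target.eventually_mem (Φ.map_source hsrc))] with t h1 h2
        rw [h1, Function.comp_apply, Φ.right_inv h2]
      · rw [(hΦ'.comp_hasDerivAt 0 hc').deriv]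
        change L'.symm _ = _
        rw [ContinuousLinearEquiv.symm_apply_eq]
        apply Prod.ext
        · exact (Submodule.orthogonalProjectionOnto_mem_subspace_eq_self (⟨v, hv⟩ : K)).symm
        · exact ((hmemK v).1 hv).symm
  rw [hTK]
  exact ⟨Φ, hsrc, fun _ => rfl, hiff, hsymm⟩

theorem IsSubmanifold.exists_paramRadius {n d : ℕ} {M : Set (RSpace n)}
    (hM : IsSubmanifold 2 d M) (hS : IsLocallySymmetric M) {a : RSpace n} (ha : a ∈ M) :
    ∃ δ₀ > 0, ∀ δ, 0 < δ → δ < δ₀ → IsParamRadius M a δ := by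
  obtain ⟨Φ, hsrc, hfst, hiff, hsymm⟩ := hM.exists_straightening ha
  obtain ⟨δ₁, hδ₁, hsym₁⟩ := hS.2 a ha
  have hev : ∀ᶠ x in 𝓝 a, x ∈ Φ.source ∧ (x ∈ M ↔ (Φ x).2 = 0) ∧
      ContDiffAt ℝ 2 Φ.symm (Φ x) ∧ (∀ i j, x i = x j → a i = a j) := by
    -- For a finite order, being `C²` at a point is an open condition, so it passes from `Φ a` to
    -- the nearby `Φ x`.
    filter_upwards [Φ.open_source.eventually_mem hsrc, hiff, eventually_eq_imp_eq a,
      (Φ.continuousAt hsrc).eventually (hsymm.eventually (by simp))] with x h1 h2 h3 h4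
    exact ⟨h1, h2, h4, h3⟩
  obtain ⟨δ₂, hδ₂, hball⟩ := Metric.eventually_nhds_iff_ball.1 hev
  refine ⟨min δ₁ δ₂, lt_min hδ₁ hδ₂, fun δ hδ hlt => ?_⟩
  have hsub₁ : ball a δ ⊆ ball a δ₁ := ball_subset_ball (hlt.le.trans (min_le_left _ _))
  have hb : ∀ x ∈ ball a δ, _ := fun x hx =>
    hball x (ball_subset_ball (hlt.le.trans (min_le_right _ _)) hx)
  have hΦ : ∀ x ∈ M ∩ ball a δ, ∀ u : tangentSpaceAt M a,
      projT M a x = a + (u : RSpace n) → Φ x = (u, 0) := by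
    intro x hx u hu
    refine Prod.ext ?_ ((hb x hx.2).2.1.1 hx.1)
    rw [hfst]
    apply Subtype.ext
    have := projT_sub M a x
    rw [hu, add_sub_cancel_left] at this
    exact this.symm
  have hparam : ∀ u : tangentSpaceAt M a, a + (u : RSpace n) ∈ paramDomain M a δ →
      Φ (tangParam M a δ (a + u)) = (u, 0) := fun u hu =>
    hΦ _ (tangParam_mem hu) u (projT_tangParam hu)
  -- In the chart `M` is the slice with second component `0`, so the parametrization is the inverse
  -- chart on that slice; openness and smoothness are read off from this.
  have hparam' : ∀ u : tangentSpaceAt M a, a + (u : RSpace n) ∈ paramDomain M a δ →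
      tangParam M a δ (a + u) = Φ.symm (u, 0) := fun u hu => by
    rw [← hparam u hu, Φ.left_inv (hb _ (tangParam_mem hu).2).1]
  refine ⟨hδ, ?_, ?_, ?_, ?_⟩
  · intro x hx τ hτ
    have hτ : permAct τ x = x := hτ
    -- Equal coordinates of `x` are equal in `a`, so a permutation fixing `x` also fixes `a`. It
    -- then preserves every ball around `a`, and symmetry passes to the smaller piece.
    have hfix : permAct τ a = a := by
      ext i
      refine (hb x hx.2).2.2.2 _ _ ?_
      conv_rhs => rw [← hτ]
      simp
    have hmem : ∀ ν, permAct ν a = a → ∀ y ∈ M ∩ ball a δ, permAct ν y ∈ M ∩ ball a δ :=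
      fun ν hν y hy => ⟨(permAct_mem_of_fix hδ₁ ha hsym₁ hν ⟨hy.1, hsub₁ hy.2⟩).1,
        permAct_mem_ball hν hy.2⟩
    apply Subset.antisymm
    · rintro _ ⟨y, hy, rfl⟩
      exact hmem τ hfix y hy
    · intro y hy
      exact ⟨permAct τ⁻¹ y, hmem _ (permAct_inv_fix hfix) y hy, permAct_permAct_inv τ y⟩
  · intro x hx y hy hxy
    let u : tangentSpaceAt M a := ⟨_, projT_sub_mem M a x⟩
    have hu : projT M a x = a + (u : RSpace n) := by simp [u]
    exact Φ.injOn (hb x hx.2).1 (hb y hy.2).1 ((hΦ x hx u hu).trans (hΦ y hy u (hxy ▸ hu)).symm)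
  · have hset : {u : tangentSpaceAt M a | a + (u : RSpace n) ∈ paramDomain M a δ} =
        (fun u : tangentSpaceAt M a => (u, (0 : EuclideanSpace ℝ (Fin (n - d))))) ⁻¹'
          (Φ.target ∩ Φ.symm ⁻¹' ball a δ) := by
      ext u
      constructor
      · intro hu
        have hu : a + (u : RSpace n) ∈ paramDomain M a δ := hu
        refine ⟨?_, ?_⟩
        · change (u, 0) ∈ Φ.target
          rw [← hparam u hu]
          exact Φ.map_source (hb _ (tangParam_mem hu).2).1
        · rw [mem_preimage, ← hparam' u hu]
          exact (tangParam_mem hu).2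
      · rintro ⟨h1, h2⟩
        have hright := Φ.right_inv h1
        refine ⟨Φ.symm (u, 0), ⟨(hb _ h2).2.1.2 (by rw [hright]), h2⟩, ?_⟩
        have := hfst (Φ.symm (u, 0))
        rw [hright] at this
        rw [← sub_eq_iff_eq_add', projT_sub]
        exact (congrArg Subtype.val this).symm
    rw [hset]
    exact (Φ.symm.isOpen_inter_preimage isOpen_ball).preimage (by fun_prop)
  · refine ContDiffOn.congr (f := fun u : tangentSpaceAt M a => Φ.symm (u, 0)) ?_ hparam'
    intro u hu
    have hu : a + (u : RSpace n) ∈ paramDomain M a δ := hu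
    have h1 : ContDiffAt ℝ 2 Φ.symm (u, 0) := by
      have := (hb _ (tangParam_mem hu).2).2.2.1
      rwa [hparam u hu] at this
    exact (h1.comp (f := fun u : tangentSpaceAt M a =>
      (u, (0 : EuclideanSpace ℝ (Fin (n - d))))) u (by fun_prop)).contDiffWithinAt

theorem exists_strata_radius {n : ℕ} {σ : Equiv.Perm (Fin n)} {a : RSpace n}
    (ha : a ∈ stratum σ) : ∃ δ₀ > 0, ∀ δ < δ₀, ∀ σ' : Equiv.Perm (Fin n),
      (stratum σ' ∩ ball a δ).Nonempty → PermLE σ σ' := by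
  obtain ⟨δ₀, hδ₀, hball⟩ := Metric.eventually_nhds_iff_ball.1 (eventually_eq_imp_eq a)
  refine ⟨δ₀, hδ₀, fun δ hδ σ' => ?_⟩
  rintro ⟨y, hy, hyb⟩ i j hij
  exact (mem_stratum_iff.1 ha i j).1
    (hball y (ball_subset_ball hδ.le hyb) i j ((mem_stratum_iff.1 hy i j).2 hij))

/-! ### The local equation -/

theorem starProjection_add_starProjection {n : ℕ} {K L : Submodule ℝ (RSpace n)} (h : L ≤ Kᗮ)
    {v : RSpace n} (hv : v ∈ K ⊔ L) : K.starProjection v + L.starProjection v = v := by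
  obtain ⟨t, ht, w, hw, rfl⟩ := Submodule.mem_sup.1 hv
  have h1 : K.starProjection (t + w) = t :=
    Submodule.eq_starProjection_of_mem_orthogonal ht (by simpa using h hw)
  have h2 : L.starProjection (t + w) = w :=
    Submodule.eq_starProjection_of_mem_orthogonal hw (by
      simpa using Submodule.orthogonal_le h (Submodule.le_orthogonal_orthogonal K ht))
  rw [h1, h2]

theorem reducedNormal_le {n : ℕ} (M : Set (RSpace n)) (σ : Equiv.Perm (Fin n)) (a : RSpace n) :
    reducedNormal M σ a ≤ (tangentSpaceAt M a)ᗮ := inf_le_left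

theorem projT_add_starProjection {n : ℕ} {M : Set (RSpace n)} {σ : Equiv.Perm (Fin n)}
    {a x : RSpace n} (hx : x - a ∈ reducedDirection M σ a) :
    projT M a x + (reducedNormal M σ a).starProjection (x - a) = x := by
  have := starProjection_add_starProjection (reducedNormal_le M σ a) hx
  rw [projT, affProj, add_assoc, this]
  abel

/-- With the base point cancelled, `phiBar` measures how far the reduced normal component of `x` is
from the displacement prescribed by `M`. -/
theorem phiBar_eq {n : ℕ} (M : Set (RSpace n)) (σ : Equiv.Perm (Fin n)) (a : RSpace n) (δ : ℝ)
    (x : RSpace n) : phiBar M σ a δ x =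
      tangDisp M a δ (projT M a x) - (reducedNormal M σ a).starProjection (x - a) := by
  rw [phiBar, projNRed, affProj]
  abel

namespace IsParamRadius

variable {n : ℕ} {M : Set (RSpace n)} {a : RSpace n} {δ : ℝ}

theorem exists_box_radius (h : IsParamRadius M a δ) (haM : a ∈ M) (σs σ : Equiv.Perm (Fin n)) :
    ∃ r : ℝ, 0 < r ∧ ∀ δ₁ δ₂ : ℝ, 0 < δ₁ → δ₁ < r → 0 < δ₂ → δ₂ < r →
      IsAdmissibleBox M σs σ a δ δ₁ δ₂ := by
  have hcont : Continuous fun x : RSpace n =>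
      (tangentSpaceAt M a).orthogonalProjectionOnto (x - a) := by fun_prop
  have hev : ∀ᶠ x in 𝓝 a, x ∈ ball a δ ∧ projT M a x ∈ paramDomain M a δ := by
    refine (Filter.Eventually.and (ball_mem_nhds a h.pos) (hcont.continuousAt.eventually_mem
      (h.isOpen.mem_nhds ?_)))
    simpa using h.mem_paramDomain_self haM
  obtain ⟨ε, hε, hball⟩ := Metric.eventually_nhds_iff_ball.1 hev
  -- The norm is at most the sum of the norms of the two parts, hence the halves.
  have hbox : ∀ δ₁ δ₂ : ℝ, δ₁ < ε / 2 → δ₂ < ε / 2 → box σs a δ₁ δ₂ ⊆ ball a ε := by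
    intro δ₁ δ₂ h1 h2 x hx
    rw [mem_box_iff] at hx
    rw [mem_ball_iff_norm]
    linarith [norm_le_partF_add_partM σs (x - a), hx.1, hx.2]
  refine ⟨ε / 2, half_pos hε, fun δ₁ δ₂ h1 h1' h2 h2' => ⟨h1, h2, fun x hx => ?_, fun x hx => ?_⟩⟩
  · exact (hball x (hbox _ _ h1' h2' hx)).1
  · exact (hball x (hbox _ _ h1' h2' hx.2)).2

theorem phiBar_mem_reducedNormal (h : IsParamRadius M a δ) (haM : a ∈ M)
    {σ : Equiv.Perm (Fin n)} (haσ : a ∈ stratum σ) {x : RSpace n}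
    (hx : projT M a x ∈ paramDomain M a δ) : phiBar M σ a δ x ∈ reducedNormal M σ a := by
  rw [phiBar_eq]
  exact Submodule.sub_mem _ (h.tangDisp_mem_reducedNormal haM haσ hx)
    (Submodule.starProjection_apply_mem _ _)

/-- A point of the reduced affine space is its tangential projection plus its reduced normal
component, so `phiBar` vanishes exactly when the point equals its own parametrized lift. Points of
`M` lie in that space because their displacement is in `N^red`. -/
theorem mem_iff_phiBar_eq_zero (h : IsParamRadius M a δ) (haM : a ∈ M)
    {σ : Equiv.Perm (Fin n)} (haσ : a ∈ stratum σ) {x : RSpace n} (hxb : x ∈ ball a δ)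
    (hmaps : x - a ∈ reducedDirection M σ a → projT M a x ∈ paramDomain M a δ) :
    x ∈ M ↔ x - a ∈ reducedDirection M σ a ∧ phiBar M σ a δ x = 0 := by
  constructor
  · intro hx
    have hp : projT M a x ∈ paramDomain M a δ := mem_image_of_mem _ ⟨hx, hxb⟩
    have hdisp : tangDisp M a δ (projT M a x) = x - projT M a x := by
      rw [tangDisp, h.tangParam_projT ⟨hx, hxb⟩]
    have hmem : x - a ∈ reducedDirection M σ a := by
      have h1 := h.tangDisp_mem_reducedNormal haM haσ hp
      rw [hdisp] at h1
      have := Submodule.add_mem_sup (projT_sub_mem M a x) h1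
      rwa [show projT M a x - a + (x - projT M a x) = x - a by abel] at this
    refine ⟨hmem, ?_⟩
    rw [phiBar_eq, hdisp, sub_eq_zero, sub_eq_iff_eq_add']
    exact (projT_add_starProjection hmem).symm
  · rintro ⟨hmem, h0⟩
    rw [phiBar_eq, sub_eq_zero, tangDisp, sub_eq_iff_eq_add',
      projT_add_starProjection hmem] at h0
    rw [← h0]
    exact (tangParam_mem (hmaps hmem)).1

theorem contDiffOn_phiBar (h : IsParamRadius M a δ) {σ : Equiv.Perm (Fin n)}
    {S : Set (reducedDirection M σ a)}
    (hS : ∀ v ∈ S, projT M a (a + (v : RSpace n)) ∈ paramDomain M a δ) :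
    ContDiffOn ℝ 2 (fun v : reducedDirection M σ a => phiBar M σ a δ (a + (v : RSpace n))) S := by
  have hval : ∀ v : reducedDirection M σ a, projT M a (a + (v : RSpace n)) =
      a + ((tangentSpaceAt M a).orthogonalProjectionOnto (v : RSpace n) : RSpace n) :=
    fun v => projT_add M a v
  have hsub : ContDiff ℝ 2 fun v : reducedDirection M σ a => (v : RSpace n) :=
    (reducedDirection M σ a).subtypeL.contDiff
  have h1 : ContDiff ℝ 2 fun v : reducedDirection M σ a =>
      (tangentSpaceAt M a).orthogonalProjectionOnto (v : RSpace n) :=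
    (tangentSpaceAt M a).orthogonalProjectionOnto.contDiff.comp hsub
  have h2 := h.contDiffOn.comp h1.contDiffOn (s := S) fun v hv => by
    have := hS v hv
    rwa [hval] at this
  have h3 : ContDiff ℝ 2 fun v : reducedDirection M σ a =>
      a + (tangentSpaceAt M a).starProjection (v : RSpace n) :=
    contDiff_const.add ((tangentSpaceAt M a).starProjection.contDiff.comp hsub)
  have h4 : ContDiff ℝ 2 fun v : reducedDirection M σ a =>
      (reducedNormal M σ a).starProjection (v : RSpace n) :=
    (reducedNormal M σ a).starProjection.contDiff.comp hsub
  refine ((h2.sub h3.contDiffOn).sub h4.contDiffOn).congr fun v _ => ?_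
  rw [phiBar_eq, tangDisp, hval, add_sub_cancel_left]
  rfl

/-- Difference quotients stay in the closed subspace `N^red`, which bounds the range. For
surjectivity no derivative of `φ` is needed: along the line `a - t • w` with `w` in `N^red`, the
tangential projection is constantly `a`, where `φ` is `0`, so `phiBar` equals `t • w`. -/
theorem range_fderiv_phiBar (h : IsParamRadius M a δ) (haM : a ∈ M)
    {σ : Equiv.Perm (Fin n)} (haσ : a ∈ stratum σ) {S : Set (reducedDirection M σ a)}
    (hopen : IsOpen S) (h0 : (0 : reducedDirection M σ a) ∈ S)
    (hS : ∀ v ∈ S, projT M a (a + (v : RSpace n)) ∈ paramDomain M a δ) :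
    LinearMap.range (fderiv ℝ
      (fun v : reducedDirection M σ a => phiBar M σ a δ (a + (v : RSpace n))) 0).toLinearMap
      = reducedNormal M σ a := by
  have hd : DifferentiableAt ℝ
      (fun v : reducedDirection M σ a => phiBar M σ a δ (a + (v : RSpace n))) 0 :=
    ((h.contDiffOn_phiBar hS).contDiffAt (hopen.mem_nhds h0)).differentiableAt two_ne_zero
  apply le_antisymm
  · rintro _ ⟨v, rfl⟩
    have hlim := hd.hasFDerivAt.hasLineDerivAt v
    have hlim : HasDerivAt (fun t : ℝ => phiBar M σ a δ (a + ((0 + t • v :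
        reducedDirection M σ a) : RSpace n))) _ 0 := hlim
    have hc : Tendsto (fun t : ℝ => 0 + t • v) (𝓝 0) (𝓝 (0 : reducedDirection M σ a)) := by
      have hc : Continuous fun t : ℝ => 0 + t • v := by fun_prop
      simpa using hc.tendsto 0
    have hclosed : IsClosed (reducedNormal M σ a : Set (RSpace n)) :=
      Submodule.closed_of_finiteDimensional _
    refine hclosed.mem_of_tendsto hlim.tendsto_slope ?_
    filter_upwards [(hc.eventually (hopen.eventually_mem h0)).filter_mono
      nhdsWithin_le_nhds] with t ht
    have ha : projT M a (a + ((0 : reducedDirection M σ a) : RSpace n)) ∈ paramDomain M a δ :=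
      hS 0 h0
    simp only [slope_def_module, zero_smul, add_zero]
    exact Submodule.smul_mem _ _ (Submodule.sub_mem _
      (h.phiBar_mem_reducedNormal haM haσ (hS _ ht)) (h.phiBar_mem_reducedNormal haM haσ ha))
  · intro w hw
    have hw' : -w ∈ reducedDirection M σ a :=
      Submodule.mem_sup_right (Submodule.neg_mem _ hw)
    refine ⟨⟨-w, hw'⟩, ?_⟩
    have hlim := hd.hasFDerivAt.hasLineDerivAt ⟨-w, hw'⟩
    have hfun : (fun t : ℝ => phiBar M σ a δ (a + ((0 + t • ⟨-w, hw'⟩ :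
        reducedDirection M σ a) : RSpace n))) = fun t : ℝ => t • w := by
      funext t
      have hmem : t • -w ∈ reducedNormal M σ a :=
        Submodule.smul_mem _ _ (Submodule.neg_mem _ hw)
      have hT : (tangentSpaceAt M a).starProjection (t • -w) = 0 :=
        (Submodule.starProjection_apply_eq_zero_iff _).2 (reducedNormal_le M σ a hmem)
      rw [phiBar_eq, zero_add, add_sub_cancel_left, projT_add, Submodule.coe_smul,
        hT, add_zero, h.tangDisp_self haM, Submodule.starProjection_eq_self_iff.2 hmem]
      simp
    have hlim : HasDerivAt (fun t : ℝ => phiBar M σ a δ (a + ((0 + t • ⟨-w, hw'⟩ :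
        reducedDirection M σ a) : RSpace n))) _ 0 := hlim
    rw [hfun] at hlim
    have := hlim.unique ((hasDerivAt_id (0 : ℝ)).smul_const w)
    rw [one_smul] at this
    exact this

theorem permAct_mem_reducedDirection (h : IsParamRadius M a δ) (haM : a ∈ M)
    {σ τ : Equiv.Perm (Fin n)} (haσ : a ∈ stratum σ) (hτ : permAct τ a = a) {v : RSpace n}
    (hv : v ∈ reducedDirection M σ a) : permAct τ v ∈ reducedDirection M σ a := by
  obtain ⟨t, ht, w, hw, rfl⟩ := Submodule.mem_sup.1 hv
  rw [permAct_add, permAct_eq_of_mem_stratumBiperp haσ hτ hw.2]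
  exact Submodule.add_mem_sup (permAct_mem_tangentSpaceAt h.pos haM h.symmetric hτ ht) hw

/-- Both terms of `phiBar` are equivariant with values in `N^red`, on which permutations fixing `a`
act trivially. -/
theorem phiBar_permAct (h : IsParamRadius M a δ) (haM : a ∈ M)
    {σ τ : Equiv.Perm (Fin n)} (haσ : a ∈ stratum σ) (hτ : permAct τ a = a) {x : RSpace n}
    (hx : projT M a x ∈ paramDomain M a δ) :
    phiBar M σ a δ (permAct τ x) = phiBar M σ a δ x := by
  have hinv : ∀ ν, permAct ν a = a → ∀ w ∈ reducedNormal M σ a,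
      permAct ν w ∈ reducedNormal M σ a := fun ν hν w hw => by
    rwa [permAct_eq_of_mem_stratumBiperp haσ hν hw.2]
  have hsub : permAct τ x - a = permAct τ (x - a) := by rw [permAct_sub, hτ]
  rw [phiBar_eq, phiBar_eq, projT_permAct h.pos haM h.symmetric hτ,
    h.tangDisp_permAct haM hτ hx,
    permAct_eq_of_mem_stratumBiperp haσ hτ (h.tangDisp_mem_reducedNormal haM haσ hx).2,
    hsub, starProjection_permAct (hinv τ hτ) (hinv _ (permAct_inv_fix hτ)),
    permAct_eq_of_mem_stratumBiperp haσ hτ (Submodule.starProjection_apply_mem _ _ :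
      (reducedNormal M σ a).starProjection (x - a) ∈ reducedNormal M σ a).2]

end IsParamRadius

theorem theorem4p7 {n d : ℕ} (M : Set (RSpace n)) (hM : IsLocallySymmetricManifold 2 d M)
    (σs : Equiv.Perm (Fin n)) (hσs : IsCharacteristic M σs)
    (σ : Equiv.Perm (Fin n)) (a : RSpace n) (haM : a ∈ M) (haσ : a ∈ stratum σ) :
    -- all sufficiently small radii are admissible
    (∃ δ₀ : ℝ, 0 < δ₀ ∧ ∀ δ : ℝ, 0 < δ → δ < δ₀ → IsAdmissibleRadius M σ a δ) ∧
    ∀ δ : ℝ, IsAdmissibleRadius M σ a δ →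
      -- all sufficiently small rectangular neighbourhoods are admissible
      (∃ r : ℝ, 0 < r ∧ ∀ δ₁ δ₂ : ℝ, 0 < δ₁ → δ₁ < r → 0 < δ₂ → δ₂ < r →
        IsAdmissibleBox M σs σ a δ δ₁ δ₂) ∧
      ∀ δ₁ δ₂ : ℝ, IsAdmissibleBox M σs σ a δ δ₁ δ₂ →
        -- `φ̄` is well defined as a map from `D` to the reduced normal space
        (∀ x ∈ reducedDomain M σs σ a δ₁ δ₂, phiBar M σ a δ x ∈ reducedNormal M σ a) ∧
        -- `φ̄` is of class `C²` on `D`, a relatively open subset of the reduced affine space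
        IsOpen {h : reducedDirection M σ a |
          a + (h : RSpace n) ∈ reducedDomain M σs σ a δ₁ δ₂} ∧
        ContDiffOn ℝ 2 (fun h : reducedDirection M σ a => phiBar M σ a δ (a + (h : RSpace n)))
          {h : reducedDirection M σ a | a + (h : RSpace n) ∈ reducedDomain M σs σ a δ₁ δ₂} ∧
        -- the Jacobian at `a` maps the reduced direction onto the reduced normal space
        LinearMap.range (fderiv ℝ
          (fun h : reducedDirection M σ a => phiBar M σ a δ (a + (h : RSpace n))) 0).toLinearMap
          = reducedNormal M σ a ∧
        -- near `a`, the manifold lies in `D` and is the zero set of `φ̄`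
        (∀ x ∈ box σs a δ₁ δ₂,
          (x ∈ M ↔ x ∈ reducedDomain M σs σ a δ₁ δ₂ ∧ phiBar M σ a δ x = 0)) ∧
        -- `D` and `φ̄` are invariant under all permutations `σ' ≿ σ`
        (∀ σ' : Equiv.Perm (Fin n), PermLE σ σ' → ∀ x ∈ reducedDomain M σs σ a δ₁ δ₂,
          permAct σ' x ∈ reducedDomain M σs σ a δ₁ δ₂ ∧
            phiBar M σ a δ (permAct σ' x) = phiBar M σ a δ x) := by
  have hr : ∀ b ∈ M, ∃ δ, IsParamRadius M b δ := fun b hb => by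
    obtain ⟨δ₀, hδ₀, hδ⟩ := hM.submanifold.exists_paramRadius hM.symmetric hb
    exact ⟨δ₀ / 2, hδ _ (half_pos hδ₀) (half_lt_self hδ₀)⟩
  refine ⟨?_, fun δ hadm => ⟨hadm.isParamRadius.exists_box_radius haM σs σ, ?_⟩⟩
  · obtain ⟨δ₁, hδ₁, h1⟩ := hM.submanifold.exists_paramRadius hM.symmetric haM
    obtain ⟨δ₂, hδ₂, h2⟩ := exists_strata_radius haσ
    refine ⟨min δ₁ δ₂, lt_min hδ₁ hδ₂, fun δ hδ hlt => ?_⟩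
    have h := h1 δ hδ (hlt.trans_le (min_le_left _ _))
    exact ⟨hδ, h2 δ (hlt.trans_le (min_le_right _ _)), h.symmetric, h.injOn, h.isOpen,
      h.contDiffOn⟩
  intro δ₁ δ₂ hbox
  have h := hadm.isParamRadius
  have hmaps : ∀ v ∈ {v : reducedDirection M σ a |
      a + (v : RSpace n) ∈ reducedDomain M σs σ a δ₁ δ₂},
      projT M a (a + (v : RSpace n)) ∈ paramDomain M a δ := fun v hv => hbox.mapsTo hv
  have hopen : IsOpen {v : reducedDirection M σ a |
      a + (v : RSpace n) ∈ reducedDomain M σs σ a δ₁ δ₂} := by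
    have hset : {v : reducedDirection M σ a |
        a + (v : RSpace n) ∈ reducedDomain M σs σ a δ₁ δ₂} =
        (fun v : reducedDirection M σ a => a + (v : RSpace n)) ⁻¹' box σs a δ₁ δ₂ := by
      ext v
      refine ⟨fun hv => hv.2, fun hv => ⟨?_, hv⟩⟩
      change a + (v : RSpace n) - a ∈ reducedDirection M σ a
      rw [add_sub_cancel_left]
      exact v.2
    rw [hset]
    exact (isOpen_box σs a δ₁ δ₂).preimage (by fun_prop)
  have hzero : (0 : reducedDirection M σ a) ∈ {v : reducedDirection M σ a |
      a + (v : RSpace n) ∈ reducedDomain M σs σ a δ₁ δ₂} := by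
    change a + ((0 : reducedDirection M σ a) : RSpace n) ∈ reducedDomain M σs σ a δ₁ δ₂
    rw [Submodule.coe_zero, add_zero]
    refine ⟨?_, mem_ball_self hbox.pos₁, mem_ball_self hbox.pos₂⟩
    change a - a ∈ reducedDirection M σ a
    rw [sub_self]
    exact Submodule.zero_mem _
  refine ⟨fun x hx => h.phiBar_mem_reducedNormal haM haσ (hbox.mapsTo hx), hopen,
    h.contDiffOn_phiBar hmaps, h.range_fderiv_phiBar haM haσ hopen hzero hmaps, ?_, ?_⟩
  · intro x hx
    rw [h.mem_iff_phiBar_eq_zero haM haσ (hbox.subset_ball hx) fun hd => hbox.mapsTo ⟨hd, hx⟩]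
    exact ⟨fun hd => ⟨⟨hd.1, hx⟩, hd.2⟩, fun hd => ⟨hd.1.1, hd.2⟩⟩
  · intro τ hle x hx
    have hτ := (permLE_iff_permAct_eq haσ).1 hle
    refine ⟨⟨?_, ?_⟩, h.phiBar_permAct haM haσ hτ (hbox.mapsTo hx)⟩
    · have := h.permAct_mem_reducedDirection haM haσ hτ hx.1
      rwa [permAct_sub, hτ] at this
    -- The box treats moved and unmoved coordinates separately, so its invariance requires `τ` to
    -- preserve the support of `σs`; connectedness of `M` enters here.
    · exact permAct_mem_box (hσs.apply_mem_support_iff hM.connected.isPreconnected hr haM hτ) hτ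
        hx.2
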